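/- Let $\mathcal C$ be a triangulated category. A $t$-structure on $\mathcal C$ is a pair $\mathcal D=(\mathcal D^{\le 0},\mathcal D^{\ge 0})$ (aisle, co-aisle) with the usual axioms, $\mathcal D^{\le n}=\mathcal D^{\le 0}[-n]$, $\mathcal D^{\ge n}=\mathcal D^{\ge 0}[-n]$, heart $\mathcal H_{\mathcal D}=\mathcal D^{\le 0}\cap\mathcal D^{\ge 0}$ and cohomological functors $H^i_{\mathcal D}:\mathcal C\to\mathcal H_{\mathcal D}$; it is non-degenerate if $\bigcap_n\mathcal D^{\le n}=0=\bigcap_n\mathcal D^{\ge n}$. For a torsion pair $(\mathcal X,\mathcal Y)$ in the abelian category $\mathcal H_{\mathcal D}$, the $t$-structure obtained by tilting $\mathcal D$ with respect to $(\mathcal X,\mathcal Y)$ has aisle $\{C : H^0_{\mathcal D}(C)\in\mathcal X,\ H^i_{\mathcal D}(C)=0\ \forall i>0\}$ and co-aisle $\{C : H^{-1}_{\mathcal D}(C)\in\mathcal Y,\ H^i_{\mathcal D}(C)=0\ \forall i<-1\}$. For $m\in\mathbb N$, a $t$-structure $\mathcal T$ is obtained from $\mathcal D$ by an iterated HRS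 procedure of length $m$ if there are $t$-structures $\mathcal E_0=\mathcal D,\mathcal E_1,\dots,\mathcal E_m=\mathcal T$ such that, for each $0\le i<m$, $\mathcal E_{i+1}$ is obtained by tilting $\mathcal E_i$ with respect to some torsion pair in $\mathcal H_{\mathcal E_i}$. A pair $(\mathcal D,\mathcal T)$ of $t$-structures is right filterable if $\mathcal D^{\ge i}\cap\mathcal T^{\ge 0}$ is the co-aisle of a $t$-structure for every $i\in\mathbb Z$, and left filterable if $\mathcal D^{\le i}\cap\mathcal T^{\le 0}$ is the aisle of a $t$-structure for every $i\in\mathbb Z$. **Statement.** Let $\mathcal D,\mathcal T$ be non-degenerate $t$-structures on $\mathcal C$ and let $m\in\mathbb N$. (1) If $(\mathcal D,\mathcal T)$ is right filterable, then $$\mathcal D^{\le -m}\subseteq\mathcal T^{\le 0}\subseteq\mathcal D^{\le 0}\qquad\text{(equivalently, } \mathcal D^{\ge 0}\subseteq\mathcal T^{\ge 0}\subseteq\mathcal D^{\ge -m}\text{)}$$ holds if and only if $\mathcal T$ is obtained from $\mathcal D$ by an iterated HRS procedure of length $m$. (2) If $(\mathcal D,\mathcal T)$ is left filterable, the same equivalences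 hold: $\mathcal D^{\le -m}\subseteq\mathcal T^{\le 0}\subseteq\mathcal D^{\le 0}$ (equivalently, $\mathcal D^{\ge 0}\subseteq\mathcal T^{\ge 0}\subseteq\mathcal D^{\ge -m}$) holds if and only if $\mathcal T$ is obtained from $\mathcal D$ by an iterated HRS procedure of length $m$. -/

import Mathlib

open CategoryTheory CategoryTheory.Limits CategoryTheory.Triangulated

universe v u

namespace IteratedHRS

/-- A torsion pair `(X, Y)` of (strictly) full subcategories of an abelian category `A`. The
definition makes sense for any preadditive category; it is applied below to the heart of a
t-structure, which is abelian. -/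
structure IsTorsionPair {A : Type u} [Category.{v} A] [Preadditive A]
    (X Y : ObjectProperty A) : Prop where
  isClosedUnderIso_left : X.IsClosedUnderIsomorphisms
  isClosedUnderIso_right : Y.IsClosedUnderIsomorphisms
  hom_eq_zero : ∀ ⦃M N : A⦄, X M → Y N → ∀ f : M ⟶ N, f = 0
  exists_shortExact : ∀ M : A, ∃ S : ShortComplex A, S.ShortExact ∧ S.X₂ = M ∧ X S.X₁ ∧ Y S.X₃

variable {C : Type u} [Category.{v} C] [Preadditive C] [HasZeroObject C] [HasShift C ℤ]
  [∀ n : ℤ, (shiftFunctor C n).Additive] [Pretriangulated C] [IsTriangulated C]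

/-- A t-structure is non-degenerate if `⋂ₙ D^{≤ n} = 0` and `⋂ₙ D^{≥ n} = 0`. -/
structure IsNonDegenerate (t : TStructure C) : Prop where
  isZero_of_le : ∀ M : C, (∀ n : ℤ, t.le n M) → IsZero M
  isZero_of_ge : ∀ M : C, (∀ n : ℤ, t.ge n M) → IsZero M

/-- The functor `τ^{≥ 0} τ^{≤ 0}` takes its values in the heart. -/
lemma heart_truncGELE_obj (t : TStructure C) (M : C) : t.heart ((t.truncGELE 0 0).obj M) :=
  (t.mem_heart_iff _).2 ⟨by dsimp; infer_instance, inferInstance⟩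

/-- The cohomological functor `H⁰` of a t-structure: `H⁰(M) = τ^{≥ 0} τ^{≤ 0} M`, as an object
of the heart. -/
noncomputable def heartH0 (t : TStructure C) : C ⥤ t.heart.FullSubcategory :=
  t.heart.lift (t.truncGELE 0 0) (heart_truncGELE_obj t)

/-- The cohomological functors `Hⁱ` of a t-structure: `Hⁱ(M) = H⁰(M[i])`. -/
noncomputable def heartH (t : TStructure C) (i : ℤ) : C ⥤ t.heart.FullSubcategory :=
  shiftFunctor C i ⋙ heartH0 t

/-- `T` is the t-structure obtained by tilting `D` with respect to the pair `(X, Y)` of full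
subcategories of the heart of `D`:
`T^{≤ 0} = {M | H⁰(M) ∈ X and Hⁱ(M) = 0 for i > 0}` and
`T^{≥ 0} = {M | H⁻¹(M) ∈ Y and Hⁱ(M) = 0 for i < -1}`. -/
structure IsTiltWith (D T : TStructure C) (X Y : ObjectProperty D.heart.FullSubcategory) :
    Prop where
  le_zero_iff : ∀ M : C, T.le 0 M ↔
    X ((heartH D 0).obj M) ∧ ∀ i : ℤ, 0 < i → IsZero ((heartH D i).obj M)
  ge_zero_iff : ∀ M : C, T.ge 0 M ↔
    Y ((heartH D (-1)).obj M) ∧ ∀ i : ℤ, i < -1 → IsZero ((heartH D i).obj M)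

/-- `T` is obtained by tilting `D` with respect to some torsion pair in the heart of `D`. -/
def IsHRSTilt (D T : TStructure C) : Prop :=
  ∃ X Y : ObjectProperty D.heart.FullSubcategory, IsTorsionPair X Y ∧ IsTiltWith D T X Y

/-- `T` is obtained from `D` by an iterated HRS procedure of length `m`: there are t-structures
`E 0 = D, E 1, …, E m = T` such that each `E (i + 1)` is obtained by tilting `E i` with respect to
a torsion pair in the heart of `E i`. (The values `E i` for `i > m` are irrelevant.) -/
def IsIteratedHRS (m : ℕ) (D T : TStructure C) : Prop :=
  ∃ E : ℕ → TStructure C, E 0 = D ∧ E m = T ∧ ∀ i < m, IsHRSTilt (E i) (E (i + 1))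

/-- A full subcategory is an aisle if it is the `≤ 0` part of a t-structure. -/
def IsAisle (P : ObjectProperty C) : Prop := ∃ E : TStructure C, E.le 0 = P

/-- A full subcategory is a co-aisle if it is the `≥ 0` part of a t-structure. -/
def IsCoaisle (P : ObjectProperty C) : Prop := ∃ E : TStructure C, E.ge 0 = P

/-- The pair `(D, T)` is right filterable: `D^{≥ i} ∩ T^{≥ 0}` is a co-aisle for all `i`. -/
def IsRightFilterable (D T : TStructure C) : Prop := ∀ i : ℤ, IsCoaisle (D.ge i ⊓ T.ge 0)

/-- The pair `(D, T)` is left filterable: `D^{≤ i} ∩ T^{≤ 0}` is an aisle for all `i`. -/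
def IsLeftFilterable (D T : TStructure C) : Prop := ∀ i : ℤ, IsAisle (D.le i ⊓ T.le 0)

end IteratedHRS

namespace IteratedHRS

open Pretriangulated ZeroObject

/-! For non-degenerate `D`, cohomology detects aisle and co-aisle, so `T` is a tilt of `D` exactly
when `D^{≤ -1} ⊆ T^{≤ 0} ⊆ D^{≤ 0}` (`IsHRSTilt.le`, `isHRSTilt_of_le`); the torsion pair is then
cut out of the heart by `T^{≤ 0}` and `T^{≥ 1}`. Each tilt costs at most one degree, so `m` tilts
give the inclusions. Conversely, filterability provides t-structures interpolating between `D` and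
`T`: co-aisles `D^{≥ -i} ∩ T^{≥ 0}` in the right case, aisles `D^{≤ 0} ∩ T^{≤ m - j}` in the left
case. Consecutive ones satisfy the one-step criterion. Non-degeneracy passes to them because their
aisles lie between two shifts of that of `D` (`IsNonDegenerate.of_le`). -/

lemma shortExact_of_isLimit_of_isColimit {A : Type u} [Category.{v} A] [Preadditive A]
    [HasZeroObject A] (S : ShortComplex A) (hf : IsLimit (KernelFork.ofι S.f S.zero))
    (hg : IsColimit (CokernelCofork.ofπ S.g S.zero)) : S.ShortExact := by
  have hf' : hf.lift (KernelFork.ofι S.f S.zero) = 𝟙 _ :=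
    Fork.IsLimit.hom_ext hf (by simp)
  have hg' : hg.desc (CokernelCofork.ofπ S.g S.zero) = 𝟙 _ :=
    Cofork.IsColimit.hom_ext hg (by simp)
  have wl : hf.lift (KernelFork.ofι S.f S.zero) ≫ (0 : S.X₁ ⟶ (0 : A)) = 0 := comp_zero
  have wr : (0 : (0 : A) ⟶ S.X₃) ≫ hg.desc (CokernelCofork.ofπ S.g S.zero) = 0 := zero_comp
  have hl : IsColimit (CokernelCofork.ofπ _ wl) := by
    have : Epi (hf.lift (KernelFork.ofι S.f S.zero)) := by rw [hf']; infer_instance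
    exact CokernelCofork.IsColimit.ofEpiOfIsZero _ this (isZero_zero A)
  have hr : IsLimit (KernelFork.ofι _ wr) := by
    have : Mono (hg.desc (CokernelCofork.ofπ S.g S.zero)) := by rw [hg']; infer_instance
    exact KernelFork.IsLimit.ofMonoOfIsZero _ this (isZero_zero A)
  -- The homology data have cycles `S.X₁`, opcycles `S.X₃` and homology `0`.
  exact { exact := ⟨⟨⟨S.X₁, 0, S.f, 0, S.zero, hf, wl, hl⟩, ⟨S.X₃, 0, S.g, 0, S.zero, hg, wr, hr⟩,
            Iso.refl _, by simp⟩, isZero_zero A⟩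
          mono_f := mono_of_isLimit_fork hf
          epi_g := epi_of_isColimit_cofork hg }

/-! ### Exactness in the heart and comparison of t-structures. -/

section

variable {C : Type u} [Category.{v} C] [Preadditive C] [HasZeroObject C] [HasShift C ℤ]
  [∀ n : ℤ, (shiftFunctor C n).Additive] [Pretriangulated C]

instance (t : TStructure C) : HasZeroObject t.heart.FullSubcategory where
  zero := ⟨⟨0, (t.mem_heart_iff _).2 ⟨inferInstance, inferInstance⟩⟩,
    (IsZero.iff_id_eq_zero _).2 (t.heart.ι.map_injective ((isZero_zero C).eq_of_src _ _))⟩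

lemma isZero_heart_iff (t : TStructure C) (M : t.heart.FullSubcategory) :
    IsZero M ↔ IsZero M.obj := by
  simp only [IsZero.iff_id_eq_zero]
  exact ⟨fun h ↦ t.heart.ι.congr_map h, fun h ↦ t.heart.ι.map_injective h⟩

/-- A distinguished triangle whose vertices are in the heart of a t-structure induces a short
exact sequence in the heart. -/
lemma heart_shortExact_of_distTriang (t : TStructure C) {S : ShortComplex t.heart.FullSubcategory}
    (h : S.X₃.obj ⟶ S.X₁.obj⟦(1 : ℤ)⟧)
    (hT : Triangle.mk (t.heart.ι.map S.f) (t.heart.ι.map S.g) h ∈ distTriang C) :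
    S.ShortExact := by
  have hLE (M : t.heart.FullSubcategory) : t.IsLE M.obj 0 := ⟨M.property.1⟩
  have hGE (M : t.heart.FullSubcategory) : t.IsGE M.obj 0 := ⟨M.property.2⟩
  have hf : Mono S.f := by
    rw [Preadditive.mono_iff_cancel_zero]
    intro B k hk
    obtain ⟨l, hl⟩ := Triangle.coyoneda_exact₂ _ (inv_rot_of_distTriang _ hT)
      (t.heart.ι.map k) (t.heart.ι.congr_map hk)
    have : t.IsGE (S.X₃.obj⟦(-1 : ℤ)⟧) 1 := t.isGE_shift _ 0 (-1) 1
    have hl0 : l = 0 := t.zero (X := B.obj) (Y := S.X₃.obj⟦(-1 : ℤ)⟧) l 0 1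
    rw [hl0, zero_comp] at hl
    exact t.heart.ι.map_injective hl
  have hg : Epi S.g := by
    rw [Preadditive.epi_iff_cancel_zero]
    intro B k hk
    obtain ⟨l, hl⟩ := Triangle.yoneda_exact₃ _ hT
      (t.heart.ι.map k) (t.heart.ι.congr_map hk)
    have : t.IsLE (S.X₁.obj⟦(1 : ℤ)⟧) (-1) := t.isLE_shift _ 0 1 (-1)
    have hl0 : l = 0 := t.zero (X := S.X₁.obj⟦(1 : ℤ)⟧) (Y := B.obj) l (-1) 0
    rw [hl0, comp_zero] at hl
    exact t.heart.ι.map_injective hl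
  have hlift {B : t.heart.FullSubcategory} (k : B ⟶ S.X₂) (hk : k ≫ S.g = 0) :
      ∃ l, l ≫ S.f = k := by
    obtain ⟨l, hl⟩ := Triangle.coyoneda_exact₂ _ hT (t.heart.ι.map k) (t.heart.ι.congr_map hk)
    exact ⟨ObjectProperty.homMk l, t.heart.ι.map_injective hl.symm⟩
  have hdesc {B : t.heart.FullSubcategory} (k : S.X₂ ⟶ B) (hk : S.f ≫ k = 0) :
      ∃ l, S.g ≫ l = k := by
    obtain ⟨l, hl⟩ := Triangle.yoneda_exact₂ _ hT (t.heart.ι.map k) (t.heart.ι.congr_map hk)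
    exact ⟨ObjectProperty.homMk l, t.heart.ι.map_injective hl.symm⟩
  exact shortExact_of_isLimit_of_isColimit S
    (KernelFork.IsLimit.ofι _ _ (fun k hk ↦ (hlift k hk).choose)
      (fun k hk ↦ (hlift k hk).choose_spec)
      (fun k hk m hm ↦ by rw [← cancel_mono S.f, hm, (hlift k hk).choose_spec]))
    (CokernelCofork.IsColimit.ofπ _ _ (fun k hk ↦ (hdesc k hk).choose)
      (fun k hk ↦ (hdesc k hk).choose_spec)
      (fun k hk m hm ↦ by rw [← cancel_epi S.g, hm, (hdesc k hk).choose_spec]))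

lemma isLE₃ (t : TStructure C) (T : Triangle C) (hT : T ∈ distTriang C) (n : ℤ)
    (h₁ : t.IsLE T.obj₁ (n + 1)) (h₂ : t.IsLE T.obj₂ n) : t.IsLE T.obj₃ n :=
  t.isLE₂ _ (rot_of_distTriang _ hT) n h₂ (t.isLE_shift T.obj₁ (n + 1) 1 n)

lemma isGE₁ (t : TStructure C) (T : Triangle C) (hT : T ∈ distTriang C) (n n' : ℤ) (hn : n + 1 = n')
    (h₂ : t.IsGE T.obj₂ n') (h₃ : t.IsGE T.obj₃ n) : t.IsGE T.obj₁ n' :=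
  t.isGE₂ _ (inv_rot_of_distTriang _ hT) n' (t.isGE_shift T.obj₃ n (-1) n') h₂

lemma le_eq_shift (t : TStructure C) (n : ℤ) : t.le n = (t.le 0).shift n :=
  (t.shift_le n 0 n (add_zero n)).symm

/-- The co-aisle is the right orthogonal of the aisle, one degree up. -/
lemma ge_le_ge_of_le_le_le {t t' : TStructure C} {a b a' b' : ℤ} (ha : a + 1 = a')
    (hb : b + 1 = b') (h : t.le a ≤ t'.le b) : t'.ge b' ≤ t.ge a' := fun M hM ↦ by
  rw [TStructure.ge_iff_isGE, t.isGE_iff_orthogonal a a' ha]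
  exact fun Y f hY ↦ t'.zero_of_isLE_of_isGE f b b' (by lia) ⟨h _ hY.le⟩ ⟨hM⟩

lemma le_le_le_of_ge_le_ge {t t' : TStructure C} {a b a' b' : ℤ} (ha : a + 1 = a')
    (hb : b + 1 = b') (h : t.ge a' ≤ t'.ge b') : t'.le b ≤ t.le a := fun M hM ↦ by
  rw [TStructure.le_iff_isLE, t.isLE_iff_orthogonal a a' ha]
  exact fun Y f hY ↦ t'.zero_of_isLE_of_isGE f b b' (by lia) ⟨hM⟩ ⟨h _ hY.ge⟩

lemma le_le_le_add {t t' : TStructure C} {a b : ℤ} (h : t.le a ≤ t'.le b) (n : ℤ) {a' b' : ℤ}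
    (ha : n + a = a') (hb : n + b = b') : t.le a' ≤ t'.le b' := by
  rw [← t.shift_le n a a' ha, ← t'.shift_le n b b' hb]
  exact fun M hM ↦ h _ hM

lemma ge_le_ge_add {t t' : TStructure C} {a b : ℤ} (h : t.ge a ≤ t'.ge b) (n : ℤ) {a' b' : ℤ}
    (ha : n + a = a') (hb : n + b = b') : t.ge a' ≤ t'.ge b' := by
  rw [← t.shift_ge n a a' ha, ← t'.shift_ge n b b' hb]
  exact fun M hM ↦ h _ hM

/-- Orthogonality raises both indices by one; a shift brings them back. -/
lemma le_le_le_iff_ge_le_ge (t t' : TStructure C) (a b : ℤ) :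
    t.le a ≤ t'.le b ↔ t'.ge b ≤ t.ge a :=
  ⟨fun h ↦ ge_le_ge_add (ge_le_ge_of_le_le_le rfl rfl h) (-1) (by lia) (by lia),
    fun h ↦ le_le_le_of_ge_le_ge (a' := b + 1) (b' := a + 1) rfl rfl
      (ge_le_ge_add h 1 (by lia) (by lia))⟩

lemma tStructure_ext_of_le {t t' : TStructure C} (h : t.le 0 = t'.le 0) : t = t' := by
  have hle : t.le = t'.le := funext fun n ↦ by rw [le_eq_shift, le_eq_shift t', h]
  have hge : t.ge = t'.ge := funext fun n ↦ le_antisymm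
    ((le_le_le_iff_ge_le_ge t' t n n).1 (by rw [hle]))
    ((le_le_le_iff_ge_le_ge t t' n n).1 (by rw [hle]))
  cases t
  cases t'
  congr

lemma tStructure_ext_of_ge {t t' : TStructure C} (h : t.ge 0 = t'.ge 0) : t = t' :=
  tStructure_ext_of_le (le_antisymm ((le_le_le_iff_ge_le_ge t t' 0 0).2 h.ge)
    ((le_le_le_iff_ge_le_ge t' t 0 0).2 h.le))

/-- The t-structure obtained by reindexing a t-structure by a translation. -/
def translate (t : TStructure C) (a : ℤ) : TStructure C where
  le n := t.le (n + a)
  ge n := t.ge (n + a)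
  le_shift n b n' h X hX := t.le_shift (n + a) b (n' + a) (by lia) X hX
  ge_shift n b n' h X hX := t.ge_shift (n + a) b (n' + a) (by lia) X hX
  zero' _ _ f hX hY := t.zero_of_isLE_of_isGE f (0 + a) (1 + a) (by lia) ⟨hX⟩ ⟨hY⟩
  le_zero_le := t.le_monotone (by lia)
  ge_one_le := t.ge_antitone (by lia)
  exists_triangle_zero_one A := t.exists_triangle A (0 + a) (1 + a) (by lia)

lemma IsNonDegenerate.of_le {D T : TStructure C} (hD : IsNonDegenerate D) {a b : ℤ}
    (h₁ : D.le a ≤ T.le 0) (h₂ : T.le 0 ≤ D.le b) : IsNonDegenerate T where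
  isZero_of_le M hM := hD.isZero_of_le M fun n ↦
    le_le_le_add h₂ (n - b) rfl (by lia) _ (hM _)
  isZero_of_ge M hM := hD.isZero_of_ge M fun n ↦
    ge_le_ge_add ((le_le_le_iff_ge_le_ge D T a 0).1 h₁) (n - a) rfl (by lia) _ (hM _)

/-- If the aisle of `T` lies between `D^{≤ -1}` and `D^{≤ 0}`, then intersecting the heart of `D`
with `T^{≤ 0}` and `T^{≥ 1}` gives a torsion pair. -/
lemma isTorsionPair_heart {D T : TStructure C} (h₁ : D.le (-1) ≤ T.le 0) (h₂ : T.le 0 ≤ D.le 0) :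
    IsTorsionPair (A := D.heart.FullSubcategory) (fun M ↦ T.le 0 M.obj) (fun M ↦ T.ge 1 M.obj) where
  isClosedUnderIso_left := ⟨fun e hM ↦ (T.le 0).prop_of_iso (D.heart.ι.mapIso e) hM⟩
  isClosedUnderIso_right := ⟨fun e hM ↦ (T.ge 1).prop_of_iso (D.heart.ι.mapIso e) hM⟩
  hom_eq_zero M N hM hN f := D.heart.ι.map_injective (T.zero' _ hM hN)
  exists_shortExact M := by
    obtain ⟨X, Y, hX, hY, f, g, h, hT⟩ := T.exists_triangle_zero_one M.obj
    have hXLE : D.IsLE X 0 := ⟨h₂ _ hX⟩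
    have hYGE : D.IsGE Y 0 := ⟨ge_le_ge_of_le_le_le (by lia) (by lia) h₁ _ hY⟩
    have hMLE : D.IsLE M.obj 0 := ⟨M.property.1⟩
    have hMGE : D.IsGE M.obj 0 := ⟨M.property.2⟩
    -- Both ends of the `T`-truncation triangle of `M` stay in the heart of `D`: `X` is an extension
    -- of `M` by `Y[-1]`, and `Y` one of `X[1]` by `M`.
    have hXGE : D.IsGE X 0 := isGE₁ D _ hT (-1) 0 (by lia) hMGE (D.isGE_of_ge Y (-1) 0)
    have hYLE : D.IsLE Y 0 := isLE₃ D _ hT 0 (D.isLE_of_le X 0 (0 + 1)) hMLE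
    let S : ShortComplex D.heart.FullSubcategory :=
      .mk (X₁ := ⟨X, hXLE.le, hXGE.ge⟩) (X₂ := M) (X₃ := ⟨Y, hYLE.le, hYGE.ge⟩)
        (ObjectProperty.homMk f) (ObjectProperty.homMk g)
        (D.heart.ι.map_injective (comp_distTriang_mor_zero₁₂ _ hT))
    exact ⟨S, heart_shortExact_of_distTriang D (S := S) h hT, rfl, hX, hY⟩

end

/-! ### Cohomology of a t-structure. -/

section

variable {C : Type u} [Category.{v} C] [Preadditive C] [HasZeroObject C] [HasShift C ℤ]
  [∀ n : ℤ, (shiftFunctor C n).Additive] [Pretriangulated C] [IsTriangulated C]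

variable (t : TStructure C)

/-- A morphism whose cone is `≥ i + 1` induces an isomorphism on `Hⁱ`. -/
lemma isZero_heartH_iff_of_isGE (T : Triangle C) (hT : T ∈ distTriang C) (i : ℤ)
    (h₃ : t.IsGE T.obj₃ (i + 1)) :
    IsZero ((heartH t i).obj T.obj₁) ↔ IsZero ((heartH t i).obj T.obj₂) := by
  rw [isZero_heart_iff, isZero_heart_iff]
  have hT' := Triangle.shift_distinguished _ hT i
  have h := t.isIso₁_truncLE_map_of_isGE _ hT' 0 1 rfl (t.isGE_shift T.obj₃ (i + 1) i 1)
  exact ((t.truncGE 0).mapIso (@asIso _ _ _ _ _ h)).isZero_iff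

/-- A morphism whose cocone is `≤ i - 1` induces an isomorphism on `Hⁱ`. -/
lemma isZero_heartH_iff_of_isLE (T : Triangle C) (hT : T ∈ distTriang C) (i j : ℤ) (hj : j + 1 = i)
    (h₁ : t.IsLE T.obj₁ j) :
    IsZero ((heartH t i).obj T.obj₂) ↔ IsZero ((heartH t i).obj T.obj₃) := by
  rw [isZero_heart_iff, isZero_heart_iff]
  have hT' := Triangle.shift_distinguished _ hT i
  have h := t.isIso₂_truncGE_map_of_isLE _ hT' (-1) 0 (by lia) (t.isLE_shift T.obj₁ j i (-1))
  exact ((t.truncGELEIsoLEGE 0 0).app _ ≪≫ (t.truncLE 0).mapIso (@asIso _ _ _ _ _ h) ≪≫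
    ((t.truncGELEIsoLEGE 0 0).app _).symm).isZero_iff

/-- For `M` in `D^{≤ 0}`, the truncation `τ^{≥ 0} M` computes `H⁰(M)`. -/
noncomputable def heartHZeroIsoTruncGE (M : C) [t.IsLE M 0] :
    ((heartH t 0).obj M).obj ≅ (t.truncGE 0).obj M :=
  (t.truncGELE 0 0).mapIso ((shiftFunctorZero C ℤ).app M) ≪≫
    (t.truncGE 0).mapIso (asIso ((t.truncLEι 0).app M))

/-- For `M` such that `M[i]` is in `D^{≥ 0}`, the truncation `τ^{≤ 0} M[i]` computes `Hⁱ(M)`. -/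
noncomputable def heartHIsoTruncLE (M : C) (i : ℤ) (_ : t.IsGE (M⟦i⟧) 0) :
    ((heartH t i).obj M).obj ≅ (t.truncLE 0).obj (M⟦i⟧) :=
  (asIso ((t.truncGEπ 0).app ((t.truncLE 0).obj (M⟦i⟧)))).symm

lemma isZero_heartH_of_isGE (M : C) (i n : ℤ) (h : i < n) [t.IsGE M n] :
    IsZero ((heartH t i).obj M) := by
  have : t.IsGE (M⟦i⟧) (n - i) := t.isGE_shift M n i (n - i)
  have : t.IsGE (M⟦i⟧) 1 := t.isGE_of_ge (M⟦i⟧) 1 (n - i)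
  rw [isZero_heart_iff]
  exact (t.truncGE 0).map_isZero (t.isZero_truncLE_obj_of_isGE 0 1 rfl _)

lemma isZero_heartH_of_isLE (M : C) (i n : ℤ) (h : n < i) [t.IsLE M n] :
    IsZero ((heartH t i).obj M) := by
  have : t.IsLE (M⟦i⟧) (n - i) := t.isLE_shift M n i (n - i)
  have : t.IsLE (M⟦i⟧) (-1) := t.isLE_of_le (M⟦i⟧) (n - i) (-1)
  rw [isZero_heart_iff]
  exact t.isZero_truncGE_obj_of_isLE (-1) 0 (by lia) ((t.truncLE 0).obj (M⟦i⟧))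

/-- If `M` is `≥ i` and `Hⁱ(M) = 0`, then `M` is `≥ i + 1`. -/
lemma isGE_succ_of_isZero_heartH (M : C) (i : ℤ) [t.IsGE M i] (h : IsZero ((heartH t i).obj M)) :
    t.IsGE M (i + 1) := by
  have h0 : t.IsGE (M⟦i⟧) 0 := t.isGE_shift M i i 0
  rw [isZero_heart_iff, (heartHIsoTruncLE t M i h0).isZero_iff,
    ← t.isGE_iff_isZero_truncLE_obj 0 1 rfl] at h
  exact t.isGE_of_shift M (i + 1) i 1

/-- If `M` is `≤ i` and `Hⁱ(M) = 0`, then `M` is `≤ i - 1`. -/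
lemma isLE_pred_of_isZero_heartH (M : C) (i : ℤ) [t.IsLE M i] (h : IsZero ((heartH t i).obj M)) :
    t.IsLE M (i - 1) := by
  have h0 : t.IsLE (M⟦i⟧) 0 := t.isLE_shift M i i 0
  rw [isZero_heart_iff] at h
  have h' : IsZero ((t.truncGE 0).obj (M⟦i⟧)) :=
    ((t.truncGE 0).mapIso (asIso ((t.truncLEι 0).app (M⟦i⟧)))).isZero_iff.1 h
  rw [← t.isLE_iff_isZero_truncGE_obj (-1) 0 (by lia)] at h'
  exact t.isLE_of_shift M (i - 1) i (-1)

variable {t}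

/-- If the cohomology of `M` vanishes above `n`, then `τ^{≥ n+1} M` has no cohomology in any degree.
Its lower bound can thus be raised forever, and non-degeneracy makes it zero. -/
lemma isLE_iff_isZero_heartH (ht : IsNonDegenerate t) (M : C) (n : ℤ) :
    t.IsLE M n ↔ ∀ i : ℤ, n < i → IsZero ((heartH t i).obj M) := by
  refine ⟨fun _ i hi ↦ isZero_heartH_of_isLE t M i n hi, fun h ↦ ?_⟩
  rw [t.isLE_iff_isZero_truncGE_obj n (n + 1) rfl]
  have key (k : ℕ) : t.IsGE ((t.truncGE (n + 1)).obj M) (n + 1 + k) := by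
    induction k with
    | zero => simpa using t.isGE_truncGE_obj M (n + 1) (n + 1)
    | succ k hk =>
      have := isGE_succ_of_isZero_heartH t ((t.truncGE (n + 1)).obj M) (n + 1 + k)
        ((isZero_heartH_iff_of_isLE t _ (t.triangleLEGE_distinguished n (n + 1) rfl M)
          (n + 1 + k) (n + k) (by lia) (t.isLE_truncLE_obj M n (n + k))).1 (h _ (by lia)))
      simpa [add_assoc] using this
  refine ht.isZero_of_ge _ fun j ↦ ?_
  have := key (j - (n + 1)).toNat
  exact (t.isGE_of_ge _ j (n + 1 + (j - (n + 1)).toNat)).ge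

lemma isGE_iff_isZero_heartH (ht : IsNonDegenerate t) (M : C) (n : ℤ) :
    t.IsGE M n ↔ ∀ i : ℤ, i < n → IsZero ((heartH t i).obj M) := by
  refine ⟨fun _ i hi ↦ isZero_heartH_of_isGE t M i n hi, fun h ↦ ?_⟩
  rw [t.isGE_iff_isZero_truncLE_obj (n - 1) n (by lia)]
  have key (k : ℕ) : t.IsLE ((t.truncLE (n - 1)).obj M) (n - 1 - k) := by
    induction k with
    | zero => simpa using t.isLE_truncLE_obj M (n - 1) (n - 1)
    | succ k hk =>
      have := isLE_pred_of_isZero_heartH t ((t.truncLE (n - 1)).obj M) (n - 1 - k)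
        ((isZero_heartH_iff_of_isGE t _ (t.triangleLEGE_distinguished (n - 1) n (by lia) M)
          (n - 1 - k) (t.isGE_truncGE_obj M n _)).2 (h _ (by lia)))
      simpa [sub_sub, add_assoc] using this
  refine ht.isZero_of_le _ fun j ↦ ?_
  have := key (n - 1 - j).toNat
  exact (t.isLE_of_le _ (n - 1 - (n - 1 - j).toNat) j).le

/-! ### Tilts and iterated tilts. -/

variable {D T : TStructure C}

lemma IsTorsionPair.prop_of_isZero {A : Type u} [Category.{v} A] [Preadditive A]
    {X Y : ObjectProperty A} (h : IsTorsionPair X Y) {M : A} (hM : IsZero M) : X M ∧ Y M := by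
  obtain ⟨S, hS, rfl, hX, hY⟩ := h.exists_shortExact M
  have := h.isClosedUnderIso_left
  have := h.isClosedUnderIso_right
  have := hS.mono_f
  have := hS.epi_g
  exact ⟨X.prop_of_iso ((IsZero.of_mono S.f hM).iso hM) hX,
    Y.prop_of_iso ((IsZero.of_epi S.g hM).iso hM) hY⟩

lemma IsHRSTilt.le (h : IsHRSTilt D T) (hD : IsNonDegenerate D) :
    D.le (-1) ≤ T.le 0 ∧ T.le 0 ≤ D.le 0 := by
  obtain ⟨X, Y, hXY, hT⟩ := h
  refine ⟨fun M hM ↦ ?_, fun M hM ↦ ?_⟩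
  · have h0 := (isLE_iff_isZero_heartH hD M (-1)).1 ⟨hM⟩
    exact (hT.le_zero_iff M).2 ⟨(hXY.prop_of_isZero (h0 0 (by lia))).1, fun i hi ↦ h0 i (by lia)⟩
  · exact ((isLE_iff_isZero_heartH hD M 0).2 ((hT.le_zero_iff M).1 hM).2).le

/-- In the triangle `τ^{≤ -1} M → M → H⁰(M)` the first term lies in `T^{≤ 0}` by `h₁`, so the other
two lie there together. -/
lemma isLE_heartH_zero_iff (h₁ : D.le (-1) ≤ T.le 0) (M : C) [D.IsLE M 0] :
    T.IsLE ((heartH D 0).obj M).obj 0 ↔ T.IsLE M 0 := by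
  have e := heartHZeroIsoTruncGE D M
  have hT := D.triangleLEGE_distinguished (-1) 0 (by lia) M
  have hK : T.IsLE ((D.truncLE (-1)).obj M) 0 := ⟨h₁ _ (D.le_of_isLE _ _)⟩
  refine ⟨fun _ ↦ T.isLE₂ _ hT 0 hK (T.isLE_of_iso e 0), fun hM ↦ ?_⟩
  have : T.IsLE ((D.truncGE 0).obj M) 0 := 
    isLE₃ T _ hT 0 (T.isLE_of_le ((D.truncLE (-1)).obj M) 0 (0 + 1)) hM
  exact T.isLE_of_iso e.symm 0

/-- Dually, use the triangle `H⁻¹(M) → M[-1] → τ^{≥ 1}(M[-1])`, whose last term lies in `T^{≥ 1}` by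
`h₂`. -/
lemma isGE_heartH_neg_one_iff (h₂ : T.le 0 ≤ D.le 0) (M : C) [D.IsGE M (-1)] :
    T.IsGE ((heartH D (-1)).obj M).obj 1 ↔ T.IsGE M 0 := by
  have h0 : D.IsGE (M⟦(-1 : ℤ)⟧) 0 := D.isGE_shift M (-1) (-1) 0
  have e := heartHIsoTruncLE D M (-1) h0
  have hT := D.triangleLEGE_distinguished 0 1 (by lia) (M⟦(-1 : ℤ)⟧)
  have hK : T.IsGE ((D.truncGE 1).obj (M⟦(-1 : ℤ)⟧)) 1 :=
    ⟨ge_le_ge_of_le_le_le (by lia) (by lia) h₂ _ (D.ge_of_isGE _ 1)⟩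
  rw [← T.isGE_shift_iff M 0 (-1) 1]
  refine ⟨fun _ ↦ T.isGE₂ _ hT 1 (T.isGE_of_iso e 1) hK, fun hM ↦ ?_⟩
  have : T.IsGE ((D.truncLE 0).obj (M⟦(-1 : ℤ)⟧)) 1 :=
    isGE₁ T _ hT 0 1 (by lia) hM (T.isGE_of_ge ((D.truncGE 1).obj (M⟦(-1 : ℤ)⟧)) 0 1)
  exact T.isGE_of_iso e.symm 1

/-- A t-structure whose aisle lies between `D^{≤ -1}` and `D^{≤ 0}` is an HRS-tilt of `D`. -/
lemma isHRSTilt_of_le (hD : IsNonDegenerate D) (h₁ : D.le (-1) ≤ T.le 0) (h₂ : T.le 0 ≤ D.le 0) :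
    IsHRSTilt D T := by
  refine ⟨_, _, isTorsionPair_heart h₁ h₂, fun M ↦ ?_, fun M ↦ ?_⟩
  · rw [← isLE_iff_isZero_heartH hD, TStructure.le_iff_isLE, TStructure.le_iff_isLE]
    refine ⟨fun hM ↦ ?_, fun ⟨hM, _⟩ ↦ (isLE_heartH_zero_iff h₁ M).1 hM⟩
    have : D.IsLE M 0 := ⟨h₂ _ hM.le⟩
    exact ⟨(isLE_heartH_zero_iff h₁ M).2 hM, this⟩
  · rw [← isGE_iff_isZero_heartH hD, TStructure.ge_iff_isGE, TStructure.ge_iff_isGE]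
    refine ⟨fun hM ↦ ?_, fun ⟨hM, _⟩ ↦ (isGE_heartH_neg_one_iff h₂ M).1 hM⟩
    have : D.IsGE M (-1) := ⟨(le_le_le_iff_ge_le_ge D T (-1) 0).1 h₁ _ hM.ge⟩
    exact ⟨(isGE_heartH_neg_one_iff h₂ M).2 hM, this⟩

lemma IsIteratedHRS.le {m : ℕ} (h : IsIteratedHRS m D T) (hD : IsNonDegenerate D) :
    D.le (-m) ≤ T.le 0 ∧ T.le 0 ≤ D.le 0 := by
  obtain ⟨E, rfl, rfl, hE⟩ := h
  suffices ∀ i ≤ m, (E 0).le (-i) ≤ (E i).le 0 ∧ (E i).le 0 ≤ (E 0).le 0 from this m le_rfl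
  intro i hi
  induction i with
  | zero => simp
  | succ i ih =>
    obtain ⟨h₁, h₂⟩ := ih (by lia)
    obtain ⟨h₃, h₄⟩ := (hE i (by lia)).le (hD.of_le h₁ h₂)
    exact ⟨(le_le_le_add h₁ (-1) (by push_cast; lia) (by lia)).trans h₃, h₄.trans h₂⟩

lemma isIteratedHRS_of_isRightFilterable {m : ℕ} (hD : IsNonDegenerate D)
    (h : IsRightFilterable D T) (h₁ : D.ge 0 ≤ T.ge 0) (h₂ : T.ge 0 ≤ D.ge (-m)) :
    IsIteratedHRS m D T := by
  choose E hE using fun i : ℕ ↦ h (-i)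
  have hE0 : E 0 = D := tStructure_ext_of_ge (by simpa [hE] using h₁)
  have hge (i : ℕ) : D.ge 0 ≤ (E i).ge 0 := by
    rw [hE]
    exact le_inf (D.ge_antitone (by lia)) h₁
  have hle (i : ℕ) : (E i).ge 0 ≤ D.ge (-i) := by
    rw [hE]
    exact inf_le_left
  refine ⟨E, hE0, tStructure_ext_of_ge (by rw [hE]; exact inf_eq_right.2 h₂), fun i _ ↦ ?_⟩
  refine isHRSTilt_of_le (hD.of_le ((le_le_le_iff_ge_le_ge _ _ _ _).2 (hle i))
    ((le_le_le_iff_ge_le_ge _ _ _ _).2 (hge i))) ((le_le_le_iff_ge_le_ge _ _ _ _).2 ?_)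
    ((le_le_le_iff_ge_le_ge _ _ _ _).2 ?_)
  -- For `M` in `D^{≥ -(i+1)} ∩ T^{≥ 0}`, the shift `M[-1]` lies in `D^{≥ -i} ∩ T^{≥ 1}`, hence in
  -- the co-aisle of `E i`.
  · rw [← (E i).shift_ge (-1) 0 (-1) (by lia), hE, hE]
    intro M ⟨hM, hM'⟩
    exact ⟨D.ge_shift _ _ _ (by push_cast; lia) M hM,
      T.ge_antitone zero_le_one _ (T.ge_shift 0 (-1) 1 (by lia) M hM')⟩
  · rw [hE, hE]
    exact inf_le_inf_right _ (D.ge_antitone (by push_cast; lia))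

lemma isIteratedHRS_of_isLeftFilterable {m : ℕ} (hD : IsNonDegenerate D)
    (h : IsLeftFilterable D T) (h₁ : D.le (-m) ≤ T.le 0) (h₂ : T.le 0 ≤ D.le 0) :
    IsIteratedHRS m D T := by
  choose F hF using h
  -- `F (j - m)` has aisle `D^{≤ j-m} ∩ T^{≤ 0}`. Translating by `m - j` fixes the `D` index at `0`,
  -- so the aisles shrink from `D^{≤ 0}` at `j = 0` to `T^{≤ 0}` at `j = m`.
  let E (j : ℕ) : TStructure C := translate (F (j - m)) (m - j)
  have hE (j : ℕ) (n : ℤ) : (E j).le n = D.le n ⊓ T.le (n + m - j) := by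
    change (F _).le _ = _
    rw [← (F _).shift_le (n + (m - j)) 0 _ (by lia), hF, ← D.shift_le (n + (m - j)) (j - m) n
      (by lia), ← T.shift_le (n + (m - j)) 0 (n + m - j) (by lia)]
    rfl
  have hle (j : ℕ) : (E j).le 0 ≤ D.le 0 := by
    rw [hE]
    exact inf_le_left
  have hge (j : ℕ) : D.le (-j) ≤ (E j).le 0 := by
    rw [hE]
    exact le_inf (D.le_monotone (by lia)) (le_le_le_add h₁ (m - j) (by lia) (by lia))
  refine ⟨E, tStructure_ext_of_le ?_, tStructure_ext_of_le ?_, fun j _ ↦ ?_⟩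
  · exact le_antisymm (hle 0) (by simpa using hge 0)
  · simpa [hE] using h₂
  · refine isHRSTilt_of_le (hD.of_le (hge j) (hle j)) ?_ ?_
    · rw [hE, hE]
      exact inf_le_inf (D.le_monotone (by lia)) (T.le_monotone (by push_cast; lia))
    · rw [hE, hE]
      exact inf_le_inf le_rfl (T.le_monotone (by push_cast; lia))

end

end IteratedHRS

theorem mainTheorem2 {C : Type u} [Category.{v} C] [Preadditive C] [HasZeroObject C]
    [HasShift C ℤ] [∀ n : ℤ, (shiftFunctor C n).Additive] [Pretriangulated C] [IsTriangulated C]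
    (D T : TStructure C) (hD : IteratedHRS.IsNonDegenerate D)
    (hT : IteratedHRS.IsNonDegenerate T) (m : ℕ) :
    (IteratedHRS.IsRightFilterable D T →
      ((D.le (-(m : ℤ)) ≤ T.le 0 ∧ T.le 0 ≤ D.le 0) ↔
        (D.ge 0 ≤ T.ge 0 ∧ T.ge 0 ≤ D.ge (-(m : ℤ)))) ∧
      ((D.le (-(m : ℤ)) ≤ T.le 0 ∧ T.le 0 ≤ D.le 0) ↔ IteratedHRS.IsIteratedHRS m D T)) ∧
    (IteratedHRS.IsLeftFilterable D T →
      ((D.le (-(m : ℤ)) ≤ T.le 0 ∧ T.le 0 ≤ D.le 0) ↔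
        (D.ge 0 ≤ T.ge 0 ∧ T.ge 0 ≤ D.ge (-(m : ℤ)))) ∧
      ((D.le (-(m : ℤ)) ≤ T.le 0 ∧ T.le 0 ≤ D.le 0) ↔ IteratedHRS.IsIteratedHRS m D T)) := by
  have key : (D.le (-(m : ℤ)) ≤ T.le 0 ∧ T.le 0 ≤ D.le 0) ↔
      (D.ge 0 ≤ T.ge 0 ∧ T.ge 0 ≤ D.ge (-(m : ℤ))) := by
    rw [IteratedHRS.le_le_le_iff_ge_le_ge, IteratedHRS.le_le_le_iff_ge_le_ge, and_comm]
  refine ⟨fun h ↦ ⟨key, fun h' ↦ ?_, fun h' ↦ h'.le hD⟩,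
    fun h ↦ ⟨key, fun h' ↦ ?_, fun h' ↦ h'.le hD⟩⟩
  · exact IteratedHRS.isIteratedHRS_of_isRightFilterable hD h (key.1 h').1 (key.1 h').2
  · exact IteratedHRS.isIteratedHRS_of_isLeftFilterable hD h h'.1 h'.2
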